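/- **Proposition 2 (Lack of Markov equivalence).** *Graphs.* A *summary graph* has a finite node set $N$, split into disjoint subsets $u$ and $v$ (either may be empty), and three kinds of edges: arrows, dashed lines and full lines. Every arrow points to a node of $u$ and starts in $u$ or in $v$, dashed lines couple nodes within $u$ only, full lines couple nodes within $v$ only, and there is no directed cycle. A *regression graph* is a summary graph without semi-directed cycles, that is, without direction-preserving cycles that contain at least one arrow and at least one undirected edge (dashed or full line); an arrow and a dashed line for the same node pair count as such a cycle. In a regression graph each node pair is thus coupled by at most one edge. A directed acyclic graph is a regression graph that has only arrows. *Paths.* A path is a sequence of nodes in which successive nodes are coupled; its inner nodes are distinct and different from the endpoints, and it is a cycle if its endpoints are equal. An inner node is a *collision node* of the path if each of its two edges on the path is a dashed line or an arrow pointing to it, and a transmitting node otherwise. A *collision path* is a path all of whose inner nodes are collision nodes. Three nodes form a *V* if the subgraph they induce has precisely two edges. A path or cycle is *chordless* if each inner node forms a V with its two neighbours on the path. (A cycle is read here as a path from a node to itself, so this condition is satisfied in particular by every cycle in at least four nodes that has no chords.) *Markov equivalence.* For disjoint $\alpha,\beta,c\subseteq N$ with $\alpha,\beta\neq\varnothing$,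 a regression graph implies $\alpha\perp\!\!\!\perp\beta\mid c$ if and only if it has no path from a node of $\alpha$ to a node of $\beta$ on which every inner collision node is in $c$ or has a descendant in $c$ and every other inner node is outside $c$. The independence structure captured by the graph is the set of all the statements $\alpha\perp\!\!\!\perp\beta\mid c$ that it implies, and two graphs in the same node set are Markov equivalent if they capture the same independence structure. *Claim.* If a regression graph contains a chordless collision path in four distinct nodes, or a chordless cycle in $n\ge 4$ nodes within $v$, then it is not Markov equivalent to any directed acyclic graph in the same node set. -/

import Mathlib

/-- A summary graph on the node set `N`. The node set is split into `u` (the complement of `v`)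
and `v`. There are three kinds of edges: arrows (`arrow k i` is the arrow that starts at `k` and
points to `i`), dashed lines and full lines. Within `u` there is a mixture of a directed acyclic
graph and of a covariance graph (dashed lines), within `v` a concentration graph (full lines), and
between `u` and `v` there are only arrows that point from `v` to `u`. -/
structure SummaryGraph (N : Type*) where
  /-- the nodes of the concentration graph -/
  v : Set N
  /-- `arrow k i`: there is an arrow from the parent `k` to the offspring `i` -/
  arrow : N → N → Prop
  /-- the dashed lines -/
  dashed : SimpleGraph N
  /-- the full lines -/
  full : SimpleGraph N
  /-- every arrow points to a node of `u`; it may start in `u` or in `v` -/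
  arrow_to : ∀ {k i : N}, arrow k i → i ∉ v
  dashed_within : ∀ {i k : N}, dashed.Adj i k → i ∉ v ∧ k ∉ v
  full_within : ∀ {i k : N}, full.Adj i k → i ∈ v ∧ k ∈ v
  /-- there is no directed cycle -/
  acyclic : ∀ i : N, ¬ Relation.TransGen arrow i i

namespace SummaryGraph

variable {N : Type*} (G : SummaryGraph N)

/-- An undirected edge: a dashed or a full line. -/
def Undirected (i k : N) : Prop := G.dashed.Adj i k ∨ G.full.Adj i k

/-- One step along an edge that is not an arrow traversed against its direction. -/
def DirectionPreservingStep (i k : N) : Prop := G.arrow i k ∨ G.Undirected i k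

/-- The graph contains a semi-directed cycle: a direction-preserving cycle with at least one arrow
(here from `a` to `b`) and at least one undirected edge (here between `c` and `d`). Since directed
cycles are excluded, it makes no difference whether nodes may be repeated. A double edge, consisting
of an arrow and a dashed line for the same node pair, is the case `c = b`, `d = a`. -/
def HasSemiDirectedCycle : Prop :=
  ∃ a b c d : N, G.arrow a b ∧ Relation.ReflTransGen G.DirectionPreservingStep b c ∧
    G.Undirected c d ∧ Relation.ReflTransGen G.DirectionPreservingStep d a

end SummaryGraph

/-- A regression graph: a summary graph without semi-directed cycles. -/
structure RegressionGraph (N : Type*) extends SummaryGraph N where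
  no_semiDirectedCycle : ¬ toSummaryGraph.HasSemiDirectedCycle

/-- A directed acyclic graph on the node set `N`. -/
structure DirectedAcyclicGraph (N : Type*) where
  arrow : N → N → Prop
  acyclic : ∀ i : N, ¬ Relation.TransGen arrow i i

/-- A directed acyclic graph as a regression graph that has arrows only. -/
def DirectedAcyclicGraph.toRegressionGraph {N : Type*} (D : DirectedAcyclicGraph N) :
    RegressionGraph N where
  v := ∅
  arrow := D.arrow
  dashed := ⊥
  full := ⊥
  arrow_to := fun _ => Set.notMem_empty _
  dashed_within := fun h => h.elim
  full_within := fun h => h.elim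
  acyclic := D.acyclic
  no_semiDirectedCycle := by
    rintro ⟨a, b, c, d, -, -, h | h, -⟩ <;> exact h.elim

namespace RegressionGraph

variable {N : Type*} (G : RegressionGraph N)

/-- The nodes `i` and `k` are coupled by an edge (of any kind and in any direction). -/
def Coupled (i k : N) : Prop :=
  G.arrow i k ∨ G.arrow k i ∨ G.dashed.Adj i k ∨ G.full.Adj i k

/-- A node pair is coupled by at most one edge. -/
theorem at_most_one_edge (i k : N) :
    ¬ (G.arrow i k ∧ G.arrow k i) ∧ ¬ (G.arrow i k ∧ G.dashed.Adj i k) ∧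
      ¬ (G.arrow i k ∧ G.full.Adj i k) ∧ ¬ (G.dashed.Adj i k ∧ G.full.Adj i k) := by
  refine ⟨fun h => G.acyclic i (.tail (.single h.1) h.2), fun h => ?_,
    fun h => G.arrow_to h.1 (G.full_within h.2).2,
    fun h => (G.dashed_within h.1).1 (G.full_within h.2).1⟩
  exact G.no_semiDirectedCycle ⟨i, k, k, i, h.1, .refl, .inl h.2.symm, .refl⟩

/-- In the two-edge path with nodes `i`, `j`, `k`, the inner node `j` is a collision node: each of
the two edges is an arrow that points to `j` or a dashed line. Otherwise `j` is a transmitting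
node. -/
def IsCollision (i j k : N) : Prop :=
  (G.arrow i j ∨ G.dashed.Adj i j) ∧ (G.arrow k j ∨ G.dashed.Adj k j)

/-- The nodes `x 0, x 1, …, x n` are the successive nodes of a path with `n ≥ 1` edges. The inner
nodes `x 1, …, x (n - 1)` are distinct and differ from the endpoints `x 0` and `x n`. The endpoints
may be equal; the path is then a cycle. Since no node pair is coupled by more than one edge, a path
is determined by its nodes. -/
structure IsPath (n : ℕ) (x : ℕ → N) : Prop where
  pos : 0 < n
  coupled : ∀ t < n, G.Coupled (x t) (x (t + 1))
  distinct : ∀ s t, s < t → t ≤ n → x s = x t → s = 0 ∧ t = n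

/-- A cycle in `n` distinct nodes: a path whose endpoints `x 0` and `x n` coincide. -/
def IsCycle (n : ℕ) (x : ℕ → N) : Prop := G.IsPath n x ∧ x 0 = x n

/-- The nodes `i`, `j`, `k` form a `V` with inner node `j`: the subgraph induced by these three
nodes has precisely the two edges that couple `j` with `i` and with `k`. -/
def IsV (i j k : N) : Prop :=
  i ≠ k ∧ G.Coupled i j ∧ G.Coupled j k ∧ ¬ G.Coupled i k

/-- A path is chordless if each inner node forms a `V` with its two neighbours on the path. A cycle
without any chords satisfies this whichever of its nodes is taken as its endpoint. -/
def Chordless (n : ℕ) (x : ℕ → N) : Prop :=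
  ∀ t, t + 1 < n → G.IsV (x t) (x (t + 1)) (x (t + 2))

/-- A collision path: all inner nodes are collision nodes. -/
def IsCollisionPath (n : ℕ) (x : ℕ → N) : Prop :=
  G.IsPath n x ∧ ∀ t, t + 1 < n → G.IsCollision (x t) (x (t + 1)) (x (t + 2))

/-- The graph contains a chordless collision path in four distinct nodes. -/
def HasChordlessCollisionPathInFourNodes : Prop :=
  ∃ x : ℕ → N, G.IsCollisionPath 3 x ∧ x 0 ≠ x 3 ∧ G.Chordless 3 x

/-- The graph contains a chordless cycle in `n` nodes within `v`. -/
def HasChordlessCycleWithin (n : ℕ) : Prop :=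
  ∃ x : ℕ → N, G.IsCycle n x ∧ (∀ t ≤ n, x t ∈ G.v) ∧ G.Chordless n x

/-- The path is active given `c`: every inner collision node is in `c` or has a descendant in `c`,
and every other inner node is outside `c`. -/
def IsActive (c : Set N) (n : ℕ) (x : ℕ → N) : Prop :=
  ∀ t, t + 1 < n →
    (G.IsCollision (x t) (x (t + 1)) (x (t + 2)) →
      ∃ d ∈ c, Relation.ReflTransGen G.arrow (x (t + 1)) d) ∧
    (¬ G.IsCollision (x t) (x (t + 1)) (x (t + 2)) → x (t + 1) ∉ c)

/-- The graph implies that `α` is independent of `β` given `c` (global Markov property): no path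
between `α` and `β` is active given `c`. -/
def Implies (α β c : Set N) : Prop :=
  ¬ ∃ (n : ℕ) (x : ℕ → N), G.IsPath n x ∧ x 0 ∈ α ∧ x n ∈ β ∧ G.IsActive c n x

/-- The independence structure captured by the graph: all statements `(α, β, c)`, read as
`α` is independent of `β` given `c`, that the graph implies. Here `α`, `β`, `c` are disjoint and
`α` and `β` are not empty. -/
def independenceStructure : Set (Set N × Set N × Set N) :=
  {s | s.1.Nonempty ∧ s.2.1.Nonempty ∧ Disjoint s.1 s.2.1 ∧ Disjoint s.1 s.2.2 ∧
    Disjoint s.2.1 s.2.2 ∧ G.Implies s.1 s.2.1 s.2.2}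

/-- Two graphs in the same node set are Markov equivalent if they capture the same independence
structure. -/
def MarkovEquivalent (G H : RegressionGraph N) : Prop :=
  G.independenceStructure = H.independenceStructure

end RegressionGraph

/-!
Two uncoupled nodes `i` and `k` of a regression graph are independent given the other nodes anterior
to them: all nodes of an active path would be anterior to `i` or `k`, so all inner nodes would be
collision nodes joined by dashed lines, and an arrow path from one of them back to `i` or `k` would
close a directed or semi-directed cycle. Hence Markov equivalent graphs have the same coupled pairs,
and, since the inner node of a `V` is a collision node exactly when it lies outside a separating
set, the same collision `V`s.

For a directed acyclic graph, the two successive collision nodes of a chordless collision path in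
four nodes would need arrows in both directions between them. Nodes in `v` are never collision
nodes, so a chordless cycle within `v` would turn into one without collision `V`s; but a node of
such a cycle without an arrow to another one, a sink, is a collision node. Since `Chordless` demands
nothing of the node at which a cycle is closed, the induction is on chordless paths: without
collision `V`s their endpoints are neither equal nor coupled.
-/

open Relation (ReflTransGen TransGen)

namespace RegressionGraph

variable {N : Type*} {G H : RegressionGraph N} {i j k l : N} {S c : Set N} {n t : ℕ} {x : ℕ → N}

theorem Coupled.symm (h : G.Coupled i k) : G.Coupled k i := by
  rcases h with h | h | h | h
  · exact .inr (.inl h)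
  · exact .inl h
  · exact .inr (.inr (.inl h.symm))
  · exact .inr (.inr (.inr h.symm))

theorem Coupled.ne (h : G.Coupled i k) : i ≠ k := by
  rintro rfl
  rcases h with h | h | h | h
  · exact G.acyclic i (.single h)
  · exact G.acyclic i (.single h)
  · exact h.ne rfl
  · exact h.ne rfl

theorem IsCollision.symm (h : G.IsCollision i j k) : G.IsCollision k j i := ⟨h.2, h.1⟩

theorem IsPath.notMem_endpoints (hx : G.IsPath n x) (ht : t + 1 < n) :
    x (t + 1) ∉ ({x 0, x n} : Set N) := by
  rintro (heq | heq)
  · have := hx.distinct 0 (t + 1) (by omega) ht.le heq.symm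
    omega
  · have := hx.distinct (t + 1) n ht le_rfl heq
    omega

theorem notMem_v_of_arrow_or_dashed (h : G.arrow i j ∨ G.dashed.Adj i j) : j ∉ G.v :=
  h.elim G.arrow_to fun h => (G.dashed_within h).2

theorem IsCollision.notMem_v (h : G.IsCollision i j k) : j ∉ G.v :=
  notMem_v_of_arrow_or_dashed h.1

theorem IsCollision.dashed_adj (hj : G.IsCollision i j k) (hk : G.IsCollision j k l) :
    G.dashed.Adj j k := by
  rcases hj.2 with hkj | hkj
  · exact hk.1.resolve_left fun hjk => (G.at_most_one_edge k j).1 ⟨hkj, hjk⟩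
  · exact hkj.symm

variable (G) in
/-- A step along an arrow or a full line. Sequences of such steps define the anterior nodes, which
play for regression graphs the role that the ancestors play for directed acyclic graphs. -/
def AnteriorStep (i k : N) : Prop := G.arrow i k ∨ G.full.Adj i k

variable (G) in
/-- The nodes that are anterior to a node of `S`, including the nodes of `S` themselves. -/
def anterior (S : Set N) : Set N := {i | ∃ k ∈ S, ReflTransGen G.AnteriorStep i k}

theorem subset_anterior (S : Set N) : S ⊆ G.anterior S := fun i hi => ⟨i, hi, .refl⟩

theorem AnteriorStep.mem_anterior (h : G.AnteriorStep i k) (hk : k ∈ G.anterior S) :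
    i ∈ G.anterior S := by
  obtain ⟨s, hs, hks⟩ := hk
  exact ⟨s, hs, .head h hks⟩

theorem mem_anterior_of_reflTransGen_arrow (h : ReflTransGen G.arrow i k)
    (hk : k ∈ G.anterior S) : i ∈ G.anterior S := by
  induction h using ReflTransGen.head_induction_on with
  | refl => exact hk
  | head hij _ ih => exact AnteriorStep.mem_anterior (.inl hij) ih

theorem Coupled.arrow_or_dashed_or_anteriorStep (h : G.Coupled i j) :
    (G.arrow i j ∨ G.dashed.Adj i j) ∨ G.AnteriorStep j i := by
  rcases h with h | h | h | h
  · exact .inl (.inl h)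
  · exact .inr (.inl h)
  · exact .inl (.inr h)
  · exact .inr (.inr h.symm)

theorem anteriorStep_or_of_not_isCollision (hij : G.Coupled i j) (hjk : G.Coupled j k)
    (h : ¬ G.IsCollision i j k) : G.AnteriorStep j i ∨ G.AnteriorStep j k := by
  rcases hij.arrow_or_dashed_or_anteriorStep with hi | hi
  · exact .inr (hjk.symm.arrow_or_dashed_or_anteriorStep.resolve_left fun hk => h ⟨hi, hk⟩)
  · exact .inl hi

theorem AnteriorStep.of_not_isCollision (hij : G.AnteriorStep i j) (hjk : G.Coupled j k)
    (h : ¬ G.IsCollision i j k) : G.AnteriorStep j k := by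
  refine hjk.symm.arrow_or_dashed_or_anteriorStep.resolve_left fun hkj => ?_
  rcases hij with hij | hij
  · exact h ⟨.inl hij, hkj⟩
  · exact notMem_v_of_arrow_or_dashed hkj (G.full_within hij).2

theorem IsActive.mem_anterior_of_isCollision (hact : G.IsActive c n x) (hc : c ⊆ G.anterior S)
    (ht : t + 1 < n) (hcol : G.IsCollision (x t) (x (t + 1)) (x (t + 2))) :
    x (t + 1) ∈ G.anterior S := by
  obtain ⟨d, hd, hxd⟩ := (hact t ht).1 hcol
  exact mem_anterior_of_reflTransGen_arrow hxd (hc hd)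

theorem IsActive.mem_anterior_of_anteriorStep_succ (hact : G.IsActive c n x)
    (hx : G.IsPath n x) (hc : c ⊆ G.anterior S) (hn : x n ∈ G.anterior S) {t : ℕ} (ht : t < n)
    (h : G.AnteriorStep (x t) (x (t + 1))) : x t ∈ G.anterior S := by
  refine h.mem_anterior ?_
  rcases Nat.lt_or_eq_of_le (Nat.succ_le_of_lt ht) with htn | rfl
  · by_cases hcol : G.IsCollision (x t) (x (t + 1)) (x (t + 2))
    · exact hact.mem_anterior_of_isCollision hc htn hcol
    · exact hact.mem_anterior_of_anteriorStep_succ hx hc hn htn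
        (h.of_not_isCollision (hx.coupled (t + 1) htn) hcol)
  · exact hn
termination_by n - t

theorem IsActive.mem_anterior_of_anteriorStep_pred (hact : G.IsActive c n x)
    (hx : G.IsPath n x) (hc : c ⊆ G.anterior S) (h0 : x 0 ∈ G.anterior S) (ht : t < n)
    (h : G.AnteriorStep (x (t + 1)) (x t)) : x (t + 1) ∈ G.anterior S := by
  refine h.mem_anterior ?_
  induction t with
  | zero => exact h0
  | succ t ih =>
    by_cases hcol : G.IsCollision (x t) (x (t + 1)) (x (t + 2))
    · exact hact.mem_anterior_of_isCollision hc ht hcol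
    · have hstep : G.AnteriorStep (x (t + 1)) (x t) :=
        h.of_not_isCollision (hx.coupled t (by omega)).symm (mt IsCollision.symm hcol)
      exact hstep.mem_anterior (ih (by omega) hstep)

theorem IsActive.mem_anterior (hact : G.IsActive c n x) (hx : G.IsPath n x)
    (hc : c ⊆ G.anterior S) (h0 : x 0 ∈ G.anterior S) (hn : x n ∈ G.anterior S)
    (ht : t + 1 < n) : x (t + 1) ∈ G.anterior S := by
  by_cases hcol : G.IsCollision (x t) (x (t + 1)) (x (t + 2))
  · exact hact.mem_anterior_of_isCollision hc ht hcol
  rcases anteriorStep_or_of_not_isCollision (hx.coupled t (by omega)) (hx.coupled (t + 1) ht)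
    hcol with hpred | hsucc
  · exact hact.mem_anterior_of_anteriorStep_pred hx hc h0 (by omega) hpred
  · exact hact.mem_anterior_of_anteriorStep_succ hx hc hn ht hsucc

theorem reflTransGen_arrow_or_exists_undirected
    (h : ReflTransGen G.DirectionPreservingStep i k) :
    ReflTransGen G.arrow i k ∨
      ∃ j l, ReflTransGen G.DirectionPreservingStep i j ∧ G.Undirected j l ∧
        ReflTransGen G.DirectionPreservingStep l k := by
  induction h with
  | refl => exact .inl .refl
  | tail hij hjk ih =>
    rcases ih with ih | ⟨j, l, hj, hjl, hl⟩
    · rcases hjk with hjk | hjk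
      · exact .inl (ih.tail hjk)
      · exact .inr ⟨_, _, hij, hjk, .refl⟩
    · exact .inr ⟨j, l, hj, hjl, hl.tail hjk⟩

theorem not_reflTransGen_of_arrow (hik : G.arrow i k) :
    ¬ ReflTransGen G.DirectionPreservingStep k i := by
  intro h
  rcases reflTransGen_arrow_or_exists_undirected h with h | ⟨j, l, hj, hjl, hl⟩
  · exact G.acyclic i (.head' hik h)
  · exact G.no_semiDirectedCycle ⟨i, k, j, l, hik, hj, hjl, hl⟩

theorem reflTransGen_arrow_of_anteriorStep (hi : i ∉ G.v)
    (h : ReflTransGen G.AnteriorStep i k) : ReflTransGen G.arrow i k := by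
  induction h using ReflTransGen.head_induction_on with
  | refl => exact .refl
  | head hij _ ih =>
    have harrow := hij.resolve_right fun hfull => hi (G.full_within hfull).1
    exact .head harrow (ih (G.arrow_to harrow))

theorem eq_of_reflTransGen_anteriorStep (hi : i ∉ G.v)
    (hik : ReflTransGen G.AnteriorStep i k)
    (hki : ReflTransGen G.DirectionPreservingStep k i) : i = k := by
  rcases (reflTransGen_arrow_of_anteriorStep hi hik).cases_head with h | ⟨j, hij, hjk⟩
  · exact h
  · have hji := (ReflTransGen.mono (fun _ _ => .inl) _ _ hjk).trans hki
    exact absurd hji (not_reflTransGen_of_arrow hij)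

theorem IsCollisionPath.reachable_dashed (hx : G.IsCollisionPath n x) (ht : t + 1 < n) :
    G.dashed.Reachable (x 1) (x (t + 1)) := by
  induction t with
  | zero => rfl
  | succ t ih =>
    have hadj := (hx.2 t (by omega)).dashed_adj (hx.2 (t + 1) ht)
    exact (ih (by omega)).trans hadj.reachable

theorem reflTransGen_of_reachable_dashed (h : G.dashed.Reachable i k) :
    ReflTransGen G.DirectionPreservingStep i k :=
  ReflTransGen.mono (fun _ _ hadj => .inr (.inl hadj)) _ _
    ((SimpleGraph.reachable_iff_reflTransGen i k).1 h)

theorem IsCollisionPath.notMem_anterior_endpoints (hx : G.IsCollisionPath n x) (hn : 1 < n) :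
    x 1 ∉ G.anterior {x 0, x n} := by
  obtain ⟨n, rfl⟩ := Nat.exists_eq_add_of_le' hn
  have hfirst : ReflTransGen G.DirectionPreservingStep (x 0) (x 1) :=
    .single ((hx.2 0 hn).1.imp_right .inl)
  have hlast : ReflTransGen G.DirectionPreservingStep (x (n + 2)) (x 1) :=
    .head ((hx.2 n (by omega)).2.imp_right .inl)
      (reflTransGen_of_reachable_dashed (hx.reachable_dashed (by omega)).symm)
  rintro ⟨k, hk, hanterior⟩
  have hback : ReflTransGen G.DirectionPreservingStep k (x 1) := by
    rcases hk with rfl | rfl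
    · exact hfirst
    · exact hlast
  have heq : x 1 = k := eq_of_reflTransGen_anteriorStep (hx.2 0 hn).notMem_v hanterior hback
  exact hx.1.notMem_endpoints hn (heq ▸ hk)

variable (G) in
/-- The nodes other than `i` and `k` that are anterior to `i` or to `k`; they separate `i` from `k`
whenever `i` and `k` are not coupled. -/
def separator (i k : N) : Set N := G.anterior {i, k} \ {i, k}

theorem implies_separator (hik : i ≠ k) (h : ¬ G.Coupled i k) :
    G.Implies {i} {k} (G.separator i k) := by
  rintro ⟨n, x, hx, rfl, rfl, hact⟩
  have hant {t : ℕ} (ht : t + 1 < n) : x (t + 1) ∈ G.anterior {x 0, x n} :=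
    hact.mem_anterior hx Set.sdiff_subset (subset_anterior _ (by simp))
      (subset_anterior _ (by simp)) ht
  have hcol : G.IsCollisionPath n x := by
    refine ⟨hx, fun t ht => by_contra fun hcol => ?_⟩
    exact (hact t ht).2 hcol ⟨hant ht, hx.notMem_endpoints ht⟩
  have hn : n = 1 := by
    have := hx.pos
    by_contra hne
    exact hcol.notMem_anterior_endpoints (by omega) (hant (t := 0) (by omega))
  subst hn
  exact h (hx.coupled 0 one_pos)

theorem separator_mem_independenceStructure (hik : i ≠ k) (h : ¬ G.Coupled i k) :
    ({i}, {k}, G.separator i k) ∈ G.independenceStructure :=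
  ⟨Set.singleton_nonempty i, Set.singleton_nonempty k, Set.disjoint_singleton.2 hik,
    Set.disjoint_singleton_left.2 fun hi => hi.2 (.inl rfl),
    Set.disjoint_singleton_left.2 fun hk => hk.2 (.inr rfl), implies_separator hik h⟩

theorem Coupled.not_implies (h : G.Coupled i k) (c : Set N) : ¬ G.Implies {i} {k} c := by
  refine not_not_intro ⟨1, fun | 0 => i | _ => k, ⟨one_pos, ?_, ?_⟩, rfl, rfl, ?_⟩
  · intro t ht
    obtain rfl : t = 0 := by omega
    exact h
  · omega
  · intro t ht
    omega

theorem not_implies_of_isCollision_iff_mem (hij : G.Coupled i j) (hjk : G.Coupled j k)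
    (h : G.IsCollision i j k ↔ j ∈ c) : ¬ G.Implies {i} {k} c := by
  refine not_not_intro
    ⟨2, fun | 0 => i | 1 => j | _ => k, ⟨two_pos, ?_, ?_⟩, rfl, rfl, ?_⟩
  · intro t ht
    obtain rfl | rfl : t = 0 ∨ t = 1 := by omega
    · exact hij
    · exact hjk
  · intro s t hst ht heq
    obtain ⟨rfl, rfl⟩ | ⟨rfl, rfl⟩ | ⟨rfl, rfl⟩ :
      (s = 0 ∧ t = 1) ∨ (s = 0 ∧ t = 2) ∨ (s = 1 ∧ t = 2) := by omega
    · exact absurd heq hij.ne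
    · exact ⟨rfl, rfl⟩
    · exact absurd heq hjk.ne
  · intro t ht
    obtain rfl : t = 0 := by omega
    exact ⟨fun hcol => ⟨j, h.1 hcol, .refl⟩, mt h.2⟩

theorem IsV.isCollision_iff_notMem (hV : G.IsV i j k) (h : G.Implies {i} {k} c) :
    G.IsCollision i j k ↔ j ∉ c := by
  have hne : ¬ (G.IsCollision i j k ↔ j ∈ c) := fun hiff =>
    not_implies_of_isCollision_iff_mem hV.2.1 hV.2.2.1 hiff h
  tauto

theorem Chordless.exists_isV_of_isV_endpoints (hx : G.Chordless (n + 1) x)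
    (hfirst : G.IsV (x (n + 1)) (x 0) (x 1)) (hlast : G.IsV (x n) (x (n + 1)) (x 0)) :
    ∀ j ∈ x '' Set.Iic (n + 1), ∃ i ∈ x '' Set.Iic (n + 1), ∃ k ∈ x '' Set.Iic (n + 1),
      G.IsV i j k := by
  have hmem {t : ℕ} (ht : t ≤ n + 1) : x t ∈ x '' Set.Iic (n + 1) := Set.mem_image_of_mem x ht
  rintro _ ⟨_ | t, ht, rfl⟩
  · exact ⟨_, hmem le_rfl, _, hmem (by omega), hfirst⟩
  · rcases Nat.lt_or_eq_of_le (Set.mem_Iic.1 ht) with htn | heq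
    · exact ⟨_, hmem (by omega), _, hmem (by omega), hx t htn⟩
    · rw [heq]
      exact ⟨_, hmem (by omega), _, hmem (by omega), hlast⟩

variable (G) in
/-- No `V` with nodes in `S` has a collision node as its inner node. On such a set
the skeleton of a directed acyclic graph is a chordal graph. -/
def NoCollisionVWithin (S : Set N) : Prop :=
  ∀ i ∈ S, ∀ j ∈ S, ∀ k ∈ S, G.IsV i j k → ¬ G.IsCollision i j k

theorem NoCollisionVWithin.mono {T : Set N} (hS : G.NoCollisionVWithin S) (hTS : T ⊆ S) :
    G.NoCollisionVWithin T :=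
  fun i hi j hj k hk => hS i (hTS hi) j (hTS hj) k (hTS hk)

theorem noCollisionVWithin_v (G : RegressionGraph N) : G.NoCollisionVWithin G.v :=
  fun _ _ _ hj _ _ _ hcol => hcol.notMem_v hj

namespace MarkovEquivalent

theorem symm (h : G.MarkovEquivalent H) : H.MarkovEquivalent G := Eq.symm h

theorem implies_separator (h : G.MarkovEquivalent H) (hik : i ≠ k) (hc : ¬ G.Coupled i k) :
    H.Implies {i} {k} (G.separator i k) :=
  (Eq.subset h (separator_mem_independenceStructure hik hc)).2.2.2.2.2

theorem coupled (h : G.MarkovEquivalent H) (hik : G.Coupled i k) : H.Coupled i k :=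
  by_contra fun hn => hik.not_implies _ (h.symm.implies_separator hik.ne hn)

theorem isV (h : G.MarkovEquivalent H) (hV : G.IsV i j k) : H.IsV i j k :=
  ⟨hV.1, h.coupled hV.2.1, h.coupled hV.2.2.1, mt h.symm.coupled hV.2.2.2⟩

theorem isCollision_iff (h : G.MarkovEquivalent H) (hV : G.IsV i j k) :
    G.IsCollision i j k ↔ H.IsCollision i j k :=
  (hV.isCollision_iff_notMem (RegressionGraph.implies_separator hV.1 hV.2.2.2)).trans
    ((h.isV hV).isCollision_iff_notMem (h.implies_separator hV.1 hV.2.2.2)).symm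

theorem chordless (h : G.MarkovEquivalent H) (hx : G.Chordless n x) : H.Chordless n x :=
  fun t ht => h.isV (hx t ht)

theorem noCollisionVWithin (h : G.MarkovEquivalent H) (hS : G.NoCollisionVWithin S) :
    H.NoCollisionVWithin S :=
  fun i hi j hj k hk hV hcol =>
    hS i hi j hj k hk (h.symm.isV hV) ((h.symm.isCollision_iff hV).1 hcol)

end MarkovEquivalent

end RegressionGraph

namespace DirectedAcyclicGraph

variable {N : Type*} {D : DirectedAcyclicGraph N} {i j k : N} {S : Set N} {x : ℕ → N}

theorem coupled_iff : D.toRegressionGraph.Coupled i k ↔ D.arrow i k ∨ D.arrow k i := by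
  simp [RegressionGraph.Coupled, toRegressionGraph]

theorem exists_sink (D : DirectedAcyclicGraph N) (hfin : S.Finite) (hne : S.Nonempty) :
    ∃ j ∈ S, ∀ i ∈ S, ¬ D.arrow j i := by
  let r : N → N → Prop := fun k j => TransGen D.arrow j k
  have : IsStrictOrder N r :=
    { irrefl := D.acyclic, trans := fun _ _ _ hij hjk => hjk.trans hij }
  by_contra! hno
  obtain ⟨i, hi⟩ := hne
  refine Set.WellFoundedOn.induction (P := fun _ => False) (hfin.wellFoundedOn (r := r)) hi
    fun j hj hmin => ?_
  obtain ⟨k, hk, hjk⟩ := hno j hj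
  exact hmin k hk (.single hjk)

theorem not_noCollisionVWithin_of_forall_isV (D : DirectedAcyclicGraph N) (hfin : S.Finite)
    (hne : S.Nonempty) (hV : ∀ j ∈ S, ∃ i ∈ S, ∃ k ∈ S, D.toRegressionGraph.IsV i j k) :
    ¬ D.toRegressionGraph.NoCollisionVWithin S := by
  intro hS
  obtain ⟨j, hj, hsink⟩ := D.exists_sink hfin hne
  obtain ⟨i, hi, k, hk, hijk⟩ := hV j hj
  have hij := (coupled_iff.1 hijk.2.1).resolve_right (hsink i hi)
  have hkj := (coupled_iff.1 hijk.2.2.1).resolve_left (hsink k hk)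
  exact hS i hi j hj k hk hijk ⟨.inl hij, .inl hkj⟩

theorem endpoints_ne_and_not_coupled_of_chordless {m : ℕ}
    (hS : D.toRegressionGraph.NoCollisionVWithin S)
    (hmem : ∀ t ≤ m + 2, x t ∈ S) (hx : D.toRegressionGraph.Chordless (m + 2) x) :
    x 0 ≠ x (m + 2) ∧ ¬ D.toRegressionGraph.Coupled (x 0) (x (m + 2)) := by
  induction m generalizing x with
  | zero => exact ⟨(hx 0 (by omega)).1, (hx 0 (by omega)).2.2.2⟩
  | succ m ih =>
    obtain ⟨hne_init, hinit⟩ := ih (fun t ht => hmem t (by omega)) fun t ht => hx t (by omega)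
    obtain ⟨hne_tail, htail⟩ := ih (x := fun t => x (t + 1)) (fun t ht => hmem _ (by omega))
      fun t ht => hx (t + 1) (by omega)
    have hfirst := (hx 0 (by omega)).2.1
    have hlast := (hx (m + 1) (by omega)).2.2.1
    refine ⟨fun heq => htail (heq ▸ hfirst.symm), fun hends => ?_⟩
    have hVfirst : D.toRegressionGraph.IsV (x (m + 3)) (x 0) (x 1) :=
      ⟨hne_tail.symm, hends.symm, hfirst, fun h => htail h.symm⟩
    have hVlast : D.toRegressionGraph.IsV (x (m + 2)) (x (m + 3)) (x 0) :=
      ⟨hne_init.symm, hlast, hends.symm, fun h => hinit h.symm⟩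
    have hsub : x '' Set.Iic (m + 3) ⊆ S := Set.image_subset_iff.2 hmem
    exact D.not_noCollisionVWithin_of_forall_isV ((Set.finite_Iic _).image x)
      (Set.nonempty_Iic.image x) (hx.exists_isV_of_isV_endpoints hVfirst hVlast) (hS.mono hsub)

end DirectedAcyclicGraph

theorem proposition2_general {N : Type*} (G : RegressionGraph N)
    (hG : G.HasChordlessCollisionPathInFourNodes ∨ ∃ n : ℕ, 4 ≤ n ∧ G.HasChordlessCycleWithin n)
    (D : DirectedAcyclicGraph N) :
    ¬ G.MarkovEquivalent D.toRegressionGraph := by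
  intro hE
  rcases hG with ⟨x, hx, -, hchord⟩ | ⟨n, hn, x, ⟨-, hclosed⟩, hv, hchord⟩
  · have hcol₁ := (hE.isCollision_iff (hchord 0 (by omega))).1 (hx.2 0 (by omega))
    have hcol₂ := (hE.isCollision_iff (hchord 1 (by omega))).1 (hx.2 1 (by omega))
    exact (hcol₁.dashed_adj hcol₂).elim
  · obtain ⟨m, rfl⟩ := Nat.exists_eq_add_of_le' (show 2 ≤ n by omega)
    have hD := hE.noCollisionVWithin G.noCollisionVWithin_v
    have hends :=
      DirectedAcyclicGraph.endpoints_ne_and_not_coupled_of_chordless hD hv (hE.chordless hchord)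
    exact hends.1 hclosed

theorem proposition2 {N : Type*} [Finite N] (G : RegressionGraph N)
    (hG : G.HasChordlessCollisionPathInFourNodes ∨ ∃ n : ℕ, 4 ≤ n ∧ G.HasChordlessCycleWithin n)
    (D : DirectedAcyclicGraph N) :
    ¬ G.MarkovEquivalent D.toRegressionGraph :=
  proposition2_general G hG D
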